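/- Let $\mu_1,\dots,\mu_n$ be Borel probability measures on $\mathbb R$ with finite second moments, let $w_1,\dots,w_n\ge 0$ with $\sum_i w_i=1$, and let $\gamma>0$. Write $W_2$ for the quadratic Wasserstein distance (with value $+\infty$ allowed) and, for Borel probability measures $\nu$ on $\mathbb R$, put $\mathbb F(\nu)=\sum_i w_iW_2^2(\nu,\mu_i)$ and $V=\inf_\nu\mathbb F(\nu)$. For a Borel function $\Phi_0:\mathbb R\to\mathbb R$ and the position $X$ with $-X=\Phi_0(Z)$, where $Z$ is the single risk factor, the Wasserstein barycentric risk measure is $$\rho_W(X)=\sup_{\nu}\Big\{\int_{\mathbb R}\Phi_0\,d\nu-\frac1{2\gamma}\big(\mathbb F(\nu)-V\big)\Big\},$$ the supremum being over all Borel probability measures on $\mathbb R$. Integrals have values in $[-\infty,\infty]$ and $\infty-\infty$ is read as $-\infty$. For a probability measure $\nu$ with distribution function $F_\nu$ let $g_\nu(s)=\inf\{x:F_\nu(x)>s\}$, $s\in(0,1)$, be its (right-continuous) quantile function, let $\mathbb S$ be the set of all quantile functions on $(0,1)$, and put $$g_B=\sum_i w_i g_{\mu_i},\qquad J(g)=\int_0^1\Big(\Phi_0(g(s))-\frac1{2\gamma}\big(g(s)-g_B(s)\big)^2\Big)ds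 .$$ A maximizer is a $g\in\mathbb S$ with $J(g)=\max_{\mathbb S}J$. **Barycentric quantile.** $V<\infty$, and $g_B$ is the quantile function of a probability measure $\mu_B$ with $\mathbb F(\mu_B)=V$. **(a)** Suppose that there are $a,b\in\mathbb R$ with $b<\frac1{2\gamma}$ and $\Phi_0(z)\le a+bz^2$ for all $z$. Then for every probability measure $\nu$ $$\int\Phi_0\,d\nu-\frac1{2\gamma}(\mathbb F(\nu)-V)=J(g_\nu),$$ and hence $\rho_W(X)=\sup_{g\in\mathbb S}J(g)$. If moreover $\Phi_0$ is upper semicontinuous, then the problem is well posed: $\rho_W(X)$ is finite and $\rho_W(X)=\max_{g\in\mathbb S}J(g)$, the maximum being attained at a quantile function; and this maximizer is unique if none of the $\mu_i$ has an atom, or if $z\mapsto\frac{z^2}{2\gamma}-\Phi_0(z)$ is strictly convex. **(b)** Let $\Phi_0$ be differentiable. 1. If $\Phi_0(z)\le a+bz^2$ for all $z$, for some $a,b\in\mathbb R$ with $b<\frac1{2\gamma}$, then every maximizer $g$ satisfies $$g(s)-\gamma\,\Phi_0'(g(s))-g_B(s)=0\qquad\text{for all } s\in(0,1).\tag{1}$$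 2. If $\Phi_0'(y)-\Phi_0'(x)\le L(y-x)$ for all $x\le y$, for some $L\in\mathbb R$ (for example, if $\Phi_0$ is $C^2$ with $\Phi_0''\le L$), and $\gamma$ is so small that $\gamma L<1$, then there is exactly one maximizer $g\in\mathbb S$, $\rho_W(X)=J(g)$, and $g$ is the only function $(0,1)\to\mathbb R$ that solves (1). -/

import Mathlib

open MeasureTheory Set

namespace BarycentricRisk

noncomputable section

/-- The extended integral `∫ f⁺ - ∫ f⁻` of a real function, with values in `[-∞, ∞]`.
In `EReal` one has `⊤ - ⊤ = ⊥`, so that `∞ - ∞` is read as `-∞`: an ill-defined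
expectation never contributes to a supremum. -/
def extIntegral {α : Type*} [MeasurableSpace α] (m : Measure α) (f : α → ℝ) : EReal :=
  ((∫⁻ x, ENNReal.ofReal (f x) ∂m : ENNReal) : EReal)
    - ((∫⁻ x, ENNReal.ofReal (-f x) ∂m : ENNReal) : EReal)

/-- The quadratic Wasserstein distance on `ℝ`: the square root of the infimum of
`∫ |x - y|² dπ` over all transport plans `π` with the given marginals. -/
def W2 (μ ν : ProbabilityMeasure ℝ) : ENNReal :=
  (⨅ (π : Measure (ℝ × ℝ)) (_ : π.fst = (μ : Measure ℝ) ∧ π.snd = (ν : Measure ℝ)),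
    ∫⁻ p, edist p.1 p.2 ^ 2 ∂π) ^ (1 / 2 : ℝ)

/-- The Fréchet function `ν ↦ ∑ i, w i * W2(ν, μ i)²` of the priors `μ`. -/
def frechet {n : ℕ} (μ : Fin n → ProbabilityMeasure ℝ) (w : Fin n → ℝ)
    (ν : ProbabilityMeasure ℝ) : ENNReal :=
  ∑ i, ENNReal.ofReal (w i) * W2 ν (μ i) ^ 2

/-- The Fréchet variance: the infimum of the Fréchet function over all probability measures. -/
def frechetVar {n : ℕ} (μ : Fin n → ProbabilityMeasure ℝ) (w : Fin n → ℝ) : ENNReal :=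
  ⨅ ν : ProbabilityMeasure ℝ, frechet μ w ν

/-- `E_ν[Φ₀(Z)] - (1 / (2γ)) * (frechet ν - frechetVar)`, where `-X = Φ₀(Z)` and `Z` has law `ν`.
It is `-∞` where the Fréchet function is infinite. -/
def riskObjective {n : ℕ} (μ : Fin n → ProbabilityMeasure ℝ) (w : Fin n → ℝ) (γ : ℝ)
    (Φ₀ : ℝ → ℝ) (ν : ProbabilityMeasure ℝ) : EReal :=
  extIntegral (ν : Measure ℝ) Φ₀
    - ((1 / (2 * γ) : ℝ) : EReal) * ((frechet μ w ν : EReal) - (frechetVar μ w : EReal))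

/-- The Wasserstein barycentric risk measure of the position `X` with `-X = Φ₀(Z)`. -/
def riskMeasure {n : ℕ} (μ : Fin n → ProbabilityMeasure ℝ) (w : Fin n → ℝ) (γ : ℝ)
    (Φ₀ : ℝ → ℝ) : EReal :=
  ⨆ ν : ProbabilityMeasure ℝ, riskObjective μ w γ Φ₀ ν

/-- The right-continuous generalized inverse of the distribution function of `ν`,
meaningful for `s ∈ (0, 1)`. -/
def quantile (ν : ProbabilityMeasure ℝ) (s : ℝ) : ℝ :=
  sInf {x : ℝ | s < ProbabilityTheory.cdf (ν : Measure ℝ) x}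

/-- The space of quantile functions: all functions that agree on `(0, 1)` with the quantile
function of a probability measure (values off `(0, 1)` play no role). -/
def quantileFunctions : Set (ℝ → ℝ) :=
  {g | ∃ ν : ProbabilityMeasure ℝ, EqOn g (quantile ν) (Ioo 0 1)}

/-- The barycentric quantile function `g_B = ∑ i, w i * g i`. -/
def baryQuantile {n : ℕ} (μ : Fin n → ProbabilityMeasure ℝ) (w : Fin n → ℝ) (s : ℝ) : ℝ :=
  ∑ i, w i * quantile (μ i) s

/-- `∫₀¹ (Φ₀(g(s)) - (g(s) - g_B(s))² / (2γ)) ds`. -/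
def quantileObjective {n : ℕ} (μ : Fin n → ProbabilityMeasure ℝ) (w : Fin n → ℝ) (γ : ℝ)
    (Φ₀ : ℝ → ℝ) (g : ℝ → ℝ) : EReal :=
  extIntegral (volume.restrict (Ioo (0 : ℝ) 1))
    (fun s => Φ₀ (g s) - 1 / (2 * γ) * (g s - baryQuantile μ w s) ^ 2)

/-- `g` is a quantile function that maximizes the quantile objective over all of them. -/
def IsMaximizer {n : ℕ} (μ : Fin n → ProbabilityMeasure ℝ) (w : Fin n → ℝ) (γ : ℝ)
    (Φ₀ : ℝ → ℝ) (g : ℝ → ℝ) : Prop :=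
  g ∈ quantileFunctions ∧
    ∀ h ∈ quantileFunctions, quantileObjective μ w γ Φ₀ h ≤ quantileObjective μ w γ Φ₀ g

/-- `g` solves `g(s) - γ Φ₀'(g(s)) - g_B(s) = 0` for all `s ∈ (0, 1)`. -/
def SolvesFOC {n : ℕ} (μ : Fin n → ProbabilityMeasure ℝ) (w : Fin n → ℝ) (γ : ℝ)
    (Φ₀ : ℝ → ℝ) (g : ℝ → ℝ) : Prop :=
  ∀ s ∈ Ioo (0 : ℝ) 1, g s - γ * deriv Φ₀ (g s) - baryQuantile μ w s = 0

/-- `Φ₀` is bounded above by a quadratic whose leading coefficient is less than `1 / (2γ)`. -/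
def SubquadraticAbove (γ : ℝ) (Φ₀ : ℝ → ℝ) : Prop :=
  ∃ a b : ℝ, b < 1 / (2 * γ) ∧ ∀ z, Φ₀ z ≤ a + b * z ^ 2

end

end BarycentricRisk

open BarycentricRisk

/-! The quantile map carries Lebesgue measure on $(0,1)$ to $\nu$ (`map_quantile`), and quantile
functions are exactly the monotone right-continuous functions (`mem_quantileFunctions_iff`). On the
line, $W_2$ is the $L^2$ distance of quantiles (`W2_sq`), so the Fréchet function splits into
$\int(g_\nu-g_B)^2$ plus a finite variance not depending on $\nu$ (`frechet_eq`). That variance is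
$V$, it cancels in the penalty, and the risk problem becomes the maximization of $J$
(`riskObjective_eq`).

$J$ is maximized pointwise: for each $y=g_B(s)$ take the best $z$ for $\Phi_0(z)-(z-y)^2/(2\gamma)$.
A best $z$ exists by coercivity and upper semicontinuity. Best points increase with $y$ whatever
$\Phi_0$ is (`IsBest.le`), so the monotonicity constraint costs nothing; choosing the largest best
point also gives right-continuity (`MonoRightCont.exists_isBest`). Conversely, a maximizer of $J$
agrees almost everywhere with a pointwise best value, and everywhere by closedness and
right-continuity (`IsMaximizer.isBest`). Uniqueness and the first-order condition are then
one-variable facts. -/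

open Filter Topology

namespace BarycentricRisk

/-! ### Quantile functions as monotone right-continuous functions. -/

/-- Lebesgue measure on the open unit interval. -/
noncomputable abbrev unitMeasure : Measure ℝ := volume.restrict (Ioo (0 : ℝ) 1)

instance : IsProbabilityMeasure unitMeasure := ⟨by simp⟩

/-- Monotone and right-continuous on the open unit interval. -/
structure MonoRightCont (g : ℝ → ℝ) : Prop where
  mono : MonotoneOn g (Ioo 0 1)
  rightCont : ∀ s ∈ Ioo (0 : ℝ) 1, ContinuousWithinAt g (Ioi s) s

theorem Ioo_mem_nhdsGT_of_mem {s : ℝ} (hs : s ∈ Ioo (0 : ℝ) 1) : Ioo (0 : ℝ) 1 ∈ 𝓝[>] s :=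
  mem_nhdsWithin_of_mem_nhds (Ioo_mem_nhds hs.1 hs.2)

/-- A property that holds almost everywhere on the unit interval holds at points that
approach any given point from the right. -/
theorem frequently_nhdsGT {p : ℝ → Prop} (hp : ∀ᵐ s ∂unitMeasure, p s)
    {s : ℝ} (hs : s ∈ Ioo (0 : ℝ) 1) : ∃ᶠ t in 𝓝[>] s, p t := by
  intro hn
  obtain ⟨t, ht, hsub⟩ := mem_nhdsGT_iff_exists_Ioo_subset.1
    (inter_mem hn (Ioo_mem_nhdsGT_of_mem hs))
  have h0 : volume (Ioo s t) = 0 := by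
    have hp' := (ae_restrict_iff' measurableSet_Ioo).1 hp
    refine measure_mono_null (fun x hx => ?_) hp'
    simp only [mem_compl_iff, mem_ofPred_eq, not_forall]
    exact ⟨(hsub hx).2, (hsub hx).1⟩
  simp only [Real.volume_Ioo, ENNReal.ofReal_eq_zero] at h0
  have : s < t := ht
  linarith

section Quantile

variable (ν : ProbabilityMeasure ℝ) {s t u : ℝ}

theorem bddBelow_lt_cdf (hs : 0 < s) :
    BddBelow {x : ℝ | s < ProbabilityTheory.cdf (ν : Measure ℝ) x} := by
  have h := (ProbabilityTheory.tendsto_cdf_atBot (ν : Measure ℝ)).eventually (gt_mem_nhds hs)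
  obtain ⟨x, hx⟩ := h.exists
  refine ⟨x, fun y hy => ?_⟩
  by_contra! hlt
  exact absurd (ProbabilityTheory.monotone_cdf (ν : Measure ℝ) hlt.le)
    (not_le.2 (hx.trans hy))

theorem nonempty_lt_cdf (hs : s < 1) :
    {x : ℝ | s < ProbabilityTheory.cdf (ν : Measure ℝ) x}.Nonempty :=
  ((ProbabilityTheory.tendsto_cdf_atTop (ν : Measure ℝ)).eventually (lt_mem_nhds hs)).exists

theorem quantile_le_of_lt_cdf (hs : 0 < s) (h : s < ProbabilityTheory.cdf (ν : Measure ℝ) u) :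
    quantile ν s ≤ u :=
  csInf_le (bddBelow_lt_cdf ν hs) h

theorem exists_of_quantile_lt (hs : s < 1) (h : quantile ν s < u) :
    ∃ x < u, s < ProbabilityTheory.cdf (ν : Measure ℝ) x := by
  obtain ⟨x, hx, hxu⟩ := exists_lt_of_csInf_lt (nonempty_lt_cdf ν hs) h
  exact ⟨x, hxu, hx⟩

/-- A near-converse of `quantile_le_of_lt_cdf`. The boundary case $u=g_\nu(s)$ comes from
right-continuity of the distribution function, at the price of a non-strict inequality. -/
theorem le_cdf_of_quantile_le (hs : s < 1) (h : quantile ν s ≤ u) :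
    s ≤ ProbabilityTheory.cdf (ν : Measure ℝ) u := by
  have hc : ContinuousWithinAt (ProbabilityTheory.cdf (ν : Measure ℝ)) (Ioi u) u :=
    ((ProbabilityTheory.cdf (ν : Measure ℝ)).right_continuous u).mono Ioi_subset_Ici_self
  refine ge_of_tendsto hc ?_
  filter_upwards [self_mem_nhdsWithin] with v hv
  obtain ⟨x, hx, hsx⟩ := exists_of_quantile_lt ν hs (h.trans_lt hv)
  exact hsx.le.trans (ProbabilityTheory.monotone_cdf _ hx.le)

theorem monoRightCont_quantile : MonoRightCont (quantile ν) where
  mono s hs t ht hst := by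
    refine le_csInf (nonempty_lt_cdf ν ht.2) fun x hx => ?_
    exact quantile_le_of_lt_cdf ν hs.1 (hst.trans_lt hx)
  rightCont s hs := by
    have hmono : MonotoneOn (quantile ν) (Ioo 0 1) := fun s hs t ht hst =>
      le_csInf (nonempty_lt_cdf ν ht.2) fun x hx => quantile_le_of_lt_cdf ν hs.1 (hst.trans_lt hx)
    refine tendsto_order.2 ⟨fun u hu => ?_, fun u hu => ?_⟩
    · filter_upwards [Ioo_mem_nhdsGT_of_mem hs, self_mem_nhdsWithin] with t ht hst
      exact hu.trans_le (hmono hs ht (le_of_lt hst))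
    · obtain ⟨x, hxu, hsx⟩ := exists_of_quantile_lt ν hs.2 hu
      filter_upwards [Ioo_mem_nhdsGT hsx, self_mem_nhdsWithin] with t ht hst
      exact (quantile_le_of_lt_cdf ν (hs.1.trans ht.1) ht.2).trans_lt hxu

end Quantile

namespace MonoRightCont

variable {g h : ℝ → ℝ}

theorem aemeasurable (hg : MonoRightCont g) : AEMeasurable g unitMeasure :=
  aemeasurable_restrict_of_monotoneOn measurableSet_Ioo hg.mono

theorem congr (hg : MonoRightCont g) (hgh : EqOn h g (Ioo 0 1)) : MonoRightCont h where
  mono := hg.mono.congr hgh.symm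
  rightCont s hs := (hg.rightCont s hs).congr_of_eventuallyEq
    (eventually_of_mem (Ioo_mem_nhdsGT_of_mem hs) hgh) (hgh hs)

/-- A monotone right-continuous function is the quantile function of its law under the
Lebesgue measure of the unit interval. -/
theorem exists_eqOn_quantile (hg : MonoRightCont g) :
    ∃ ν : ProbabilityMeasure ℝ, EqOn (quantile ν) g (Ioo 0 1) := by
  have hm := hg.aemeasurable
  have : IsProbabilityMeasure (unitMeasure.map g) := Measure.isProbabilityMeasure_map hm
  refine ⟨⟨unitMeasure.map g, this⟩, fun s hs => ?_⟩
  have hcdf : ∀ x, ProbabilityTheory.cdf (unitMeasure.map g) x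
      = volume.real (g ⁻¹' Iic x ∩ Ioo 0 1) := fun x => by
    rw [ProbabilityTheory.cdf_eq_real, map_measureReal_apply_of_aemeasurable hm measurableSet_Iic,
      measureReal_def, Measure.restrict_apply₀' measurableSet_Ioo.nullMeasurableSet, measureReal_def]
  have hfin : ∀ A : Set ℝ, volume (A ∩ Ioo (0 : ℝ) 1) ≠ ⊤ := fun A =>
    ne_top_of_le_ne_top (by simp) (measure_mono (inter_subset_right (s := A)))
  have hle : ∀ x, s < ProbabilityTheory.cdf (unitMeasure.map g) x → g s ≤ x := by
    intro x hx
    by_contra! hlt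
    have hsub : g ⁻¹' Iic x ∩ Ioo 0 1 ⊆ Ioo 0 s := by
      rintro t ⟨htx, ht⟩
      refine ⟨ht.1, ?_⟩
      by_contra! hst
      exact absurd (hg.mono hs ht hst) (not_le.2 (lt_of_le_of_lt htx hlt))
    have := measureReal_mono hsub (μ := volume) (by simp)
    rw [hcdf] at hx
    simp [hs.1.le] at this
    linarith
  refine le_antisymm ?_ (le_csInf (nonempty_lt_cdf _ hs.2) hle)
  refine le_of_forall_gt fun u hu => ?_
  obtain ⟨v, hgv, hvu⟩ := exists_between hu
  obtain ⟨t, ⟨htv, ht⟩, hst⟩ := (((hg.rightCont s hs).eventually (gt_mem_nhds hgv)).and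
    (Ioo_mem_nhdsGT_of_mem hs)).and self_mem_nhdsWithin |>.exists
  refine lt_of_le_of_lt (quantile_le_of_lt_cdf _ hs.1 ?_) hvu
  refine lt_of_lt_of_le (mem_Ioi.1 hst) ?_
  change t ≤ ProbabilityTheory.cdf (unitMeasure.map g) v
  rw [hcdf]
  have hsub : Ioo 0 t ⊆ g ⁻¹' Iic v ∩ Ioo 0 1 := fun r hr =>
    ⟨(hg.mono ⟨hr.1, hr.2.trans ht.2⟩ ht hr.2.le).trans htv.le, hr.1, hr.2.trans ht.2⟩
  have := measureReal_mono hsub (μ := volume) (hfin _)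
  simpa [ht.1.le] using this

end MonoRightCont

theorem mem_quantileFunctions_iff {g : ℝ → ℝ} : g ∈ quantileFunctions ↔ MonoRightCont g := by
  refine ⟨fun ⟨ν, hν⟩ => (monoRightCont_quantile ν).congr hν, fun hg => ?_⟩
  obtain ⟨ν, hν⟩ := hg.exists_eqOn_quantile
  exact ⟨ν, hν.symm⟩

/-- The quantile function transports Lebesgue measure on the unit interval to the measure. -/
theorem map_quantile (ν : ProbabilityMeasure ℝ) :
    unitMeasure.map (quantile ν) = (ν : Measure ℝ) := by
  have hm := (monoRightCont_quantile ν).aemeasurable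
  have : IsProbabilityMeasure (unitMeasure.map (quantile ν)) :=
    Measure.isProbabilityMeasure_map hm
  refine Measure.ext_of_Iic _ _ fun u => ?_
  rw [Measure.map_apply_of_aemeasurable hm measurableSet_Iic,
    Measure.restrict_apply₀' measurableSet_Ioo.nullMeasurableSet, ← ProbabilityTheory.ofReal_cdf]
  have h1 : ProbabilityTheory.cdf (ν : Measure ℝ) u ≤ 1 := ProbabilityTheory.cdf_le_one _ u
  refine le_antisymm ?_ ?_
  -- The preimage of $(-\infty,u]$ lies between $(0,F(u))$ and $(0,F(u)]$, which have the same
  -- length.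
  · refine (measure_mono (t := Ioc 0 (ProbabilityTheory.cdf (ν : Measure ℝ) u)) ?_).trans (by simp)
    exact fun s hs => ⟨hs.2.1, le_cdf_of_quantile_le ν hs.2.2 hs.1⟩
  · refine le_trans (by simp) (measure_mono (s := Ioo 0 (ProbabilityTheory.cdf (ν : Measure ℝ) u)) ?_)
    exact fun s hs => ⟨quantile_le_of_lt_cdf ν hs.1 hs.2, hs.1, hs.2.trans_le h1⟩

/-- A flat stretch of the quantile function would transport an interval of positive length to one
point, creating an atom. -/
theorem strictMonoOn_quantile (ν : ProbabilityMeasure ℝ)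
    (hν : ∀ x : ℝ, (ν : Measure ℝ) {x} = 0) : StrictMonoOn (quantile ν) (Ioo 0 1) := by
  intro s hs t ht hst
  have hmono := (monoRightCont_quantile ν).mono
  refine lt_of_le_of_ne (hmono hs ht hst.le) fun heq => ?_
  have h0 := hν (quantile ν s)
  rw [← map_quantile ν, Measure.map_apply_of_aemeasurable
    (monoRightCont_quantile ν).aemeasurable (measurableSet_singleton _),
    Measure.restrict_apply₀' measurableSet_Ioo.nullMeasurableSet] at h0
  have hsub : Ioo s t ⊆ quantile ν ⁻¹' {quantile ν s} ∩ Ioo 0 1 := fun r hr => by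
    have hr' : r ∈ Ioo (0 : ℝ) 1 := ⟨hs.1.trans hr.1, hr.2.trans ht.2⟩
    exact ⟨le_antisymm ((hmono hr' ht hr.2.le).trans heq.ge) (hmono hs hr' hr.1.le), hr'⟩
  have := measure_mono_null hsub h0
  simp only [Real.volume_Ioo, ENNReal.ofReal_eq_zero] at this
  linarith

/-! ### The barycentric quantile function. -/

section Bary

variable {n : ℕ} (μ : Fin n → ProbabilityMeasure ℝ) {w : Fin n → ℝ}

theorem monoRightCont_baryQuantile (hw : w ∈ stdSimplex ℝ (Fin n)) :
    MonoRightCont (baryQuantile μ w) where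
  mono _ hs _ ht hst := Finset.sum_le_sum fun i _ =>
    mul_le_mul_of_nonneg_left ((monoRightCont_quantile (μ i)).mono hs ht hst) (hw.1 i)
  rightCont s hs := tendsto_finsetSum _ fun i _ =>
    ((monoRightCont_quantile (μ i)).rightCont s hs).const_mul (w i)

theorem strictMonoOn_baryQuantile (hw : w ∈ stdSimplex ℝ (Fin n))
    (hμ : ∀ i, ∀ x : ℝ, (μ i : Measure ℝ) {x} = 0) :
    StrictMonoOn (baryQuantile μ w) (Ioo 0 1) := by
  intro s hs t ht hst
  obtain ⟨i, hi⟩ : ∃ i, 0 < w i := by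
    by_contra! hn
    have := Finset.sum_nonpos fun i (_ : i ∈ Finset.univ) => hn i
    rw [hw.2] at this
    linarith
  refine Finset.sum_lt_sum (fun j _ => mul_le_mul_of_nonneg_left
    ((monoRightCont_quantile (μ j)).mono hs ht hst.le) (hw.1 j)) ⟨i, Finset.mem_univ _, ?_⟩
  exact mul_lt_mul_of_pos_left (strictMonoOn_quantile (μ i) (hμ i) hs ht hst) hi

end Bary

/-! ### The Wasserstein distance on the line by a layer-cake formula. -/

section LayerCake

/-- The indicator of the triangle `x ≤ u ≤ v < y`. -/
noncomputable def triangle (p q : ℝ × ℝ) : ENNReal :=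
  {r : (ℝ × ℝ) × ℝ × ℝ | r.1.1 ≤ r.2.1 ∧ r.2.1 ≤ r.2.2 ∧ r.2.2 < r.1.2}.indicator 1 (p, q)

theorem measurable_triangle : Measurable (Function.uncurry triangle) := by
  refine Measurable.indicator (f := 1) measurable_const ?_
  simp only [ofPred_and]
  refine (measurableSet_le ?_ ?_).inter ((measurableSet_le ?_ ?_).inter (measurableSet_lt ?_ ?_))
  all_goals fun_prop

theorem two_mul_lintegral_triangle (x y : ℝ) :
    2 * ∫⁻ q : ℝ × ℝ, triangle (x, y) q = ENNReal.ofReal (y - x) ^ 2 := by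
  have hm : Measurable (triangle (x, y)) :=
    measurable_triangle.comp (measurable_const.prodMk measurable_id)
  have h1 : ∫⁻ q : ℝ × ℝ, triangle (x, y) q
      = ∫⁻ u, (Ioo x y).indicator (fun u => ENNReal.ofReal (y - u)) u := by
    rw [Measure.volume_eq_prod, lintegral_prod _ hm.aemeasurable]
    -- The slice at $u=x$ is not empty although $x\notin(x,y)$; this null set is discarded.
    refine lintegral_congr_ae ?_
    have : ∀ᵐ u : ℝ, u ≠ x := by simp [ae_iff]
    filter_upwards [this] with u hux
    by_cases hu : u ∈ Ioo x y
    · have : ∀ v, triangle (x, y) (u, v) = (Ico u y).indicator 1 v := fun v => by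
        simp only [triangle, indicator, mem_ofPred_eq, mem_Ico, hu.1.le, true_and, Pi.one_apply]
      simp [this, hu]
    · have : ∀ v, triangle (x, y) (u, v) = 0 := fun v => by
        simp only [triangle, indicator, mem_ofPred_eq]
        rw [if_neg]
        rintro ⟨h1, h2, h3⟩
        exact hu ⟨lt_of_le_of_ne h1 (Ne.symm hux), h2.trans_lt h3⟩
      simp [this, hu]
  rw [h1, lintegral_indicator measurableSet_Ioo]
  rcases le_total y x with hyx | hxy
  · simp [hyx, ENNReal.ofReal_of_nonpos (sub_nonpos.2 hyx)]
  · rw [restrict_Ioo_eq_restrict_Ioc, ← ofReal_integral_eq_lintegral_ofReal]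
    · rw [← intervalIntegral.integral_of_le hxy]
      have : ∫ u in x..y, (y - u) = (y - x) ^ 2 / 2 := by
        rw [intervalIntegral.integral_comp_sub_left (fun t => t) y]
        simp
      rw [this, ← ENNReal.ofReal_pow (by linarith), show (2 : ENNReal) = ENNReal.ofReal 2 by simp,
        ← ENNReal.ofReal_mul (by norm_num)]
      congr 1
      ring
    · exact (Continuous.integrableOn_Icc (by fun_prop)).mono_set Ioc_subset_Icc_self
    · filter_upwards [ae_restrict_mem measurableSet_Ioc] with u hu
      simpa using hu.2

/-- By Tonelli the one-sided quadratic cost is a mixture of the quadrant masses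
$\pi((-\infty,u]\times(v,\infty))$, $u\le v$. A plan that minimizes all of these therefore minimizes
the cost. -/
theorem lintegral_ofReal_sub_sq (π : Measure (ℝ × ℝ)) [SFinite π] :
    ∫⁻ p, ENNReal.ofReal (p.2 - p.1) ^ 2 ∂π
      = 2 * ∫⁻ q : ℝ × ℝ, (∫⁻ p, triangle p q ∂π) := by
  rw [← lintegral_lintegral_swap measurable_triangle.aemeasurable, ← lintegral_const_mul]
  · exact lintegral_congr fun p => (two_mul_lintegral_triangle p.1 p.2).symm
  · exact measurable_triangle.lintegral_prod_right'

theorem lintegral_triangle (π : Measure (ℝ × ℝ)) (u v : ℝ) :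
    ∫⁻ p, triangle p (u, v) ∂π = if u ≤ v then π (Iic u ×ˢ Ioi v) else 0 := by
  split_ifs with h
  · rw [← lintegral_indicator_one]
    · refine lintegral_congr fun p => ?_
      simp only [triangle, indicator, mem_ofPred_eq, h, true_and, mem_prod, mem_Iic, mem_Ioi,
        Pi.one_apply]
    · exact measurableSet_Iic.prod measurableSet_Ioi
  · simp [triangle, indicator, h]

end LayerCake

variable (ν μ : ProbabilityMeasure ℝ)

/-- The comonotone transport plan. -/
noncomputable def comonotonePlan : Measure (ℝ × ℝ) :=
  unitMeasure.map fun s => (quantile ν s, quantile μ s)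

theorem aemeasurable_quantile : AEMeasurable (quantile ν) unitMeasure :=
  (monoRightCont_quantile ν).aemeasurable

theorem aemeasurable_quantile_prodMk :
    AEMeasurable (fun s => (quantile ν s, quantile μ s)) unitMeasure :=
  (aemeasurable_quantile ν).prodMk (aemeasurable_quantile μ)

theorem comonotonePlan_fst : (comonotonePlan ν μ).fst = (ν : Measure ℝ) := by
  rw [comonotonePlan, Measure.fst_map_prodMk₀ (aemeasurable_quantile μ), map_quantile]

theorem comonotonePlan_snd : (comonotonePlan ν μ).snd = (μ : Measure ℝ) := by
  rw [comonotonePlan, Measure.snd_map_prodMk₀ (aemeasurable_quantile ν), map_quantile]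

instance : IsProbabilityMeasure (comonotonePlan ν μ) :=
  Measure.isProbabilityMeasure_map (aemeasurable_quantile_prodMk ν μ)

/-- The comonotone plan minimizes the mass of all north-west quadrants. -/
theorem comonotonePlan_quadrant_le {π : Measure (ℝ × ℝ)} (h1 : π.fst = (ν : Measure ℝ))
    (h2 : π.snd = (μ : Measure ℝ)) (u v : ℝ) :
    comonotonePlan ν μ (Iic u ×ˢ Ioi v) ≤ π (Iic u ×ˢ Ioi v) := by
  have hms : MeasurableSet (Iic u ×ˢ Ioi v) :=
    measurableSet_Iic.prod measurableSet_Ioi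
  have hle : comonotonePlan ν μ (Iic u ×ˢ Ioi v)
      ≤ (ν : Measure ℝ) (Iic u) - (μ : Measure ℝ) (Iic v) := by
    rw [comonotonePlan, Measure.map_apply_of_aemeasurable (aemeasurable_quantile_prodMk ν μ) hms,
      Measure.restrict_apply₀' measurableSet_Ioo.nullMeasurableSet, ← ProbabilityTheory.ofReal_cdf,
      ← ProbabilityTheory.ofReal_cdf, ← ENNReal.ofReal_sub _ (ProbabilityTheory.cdf_nonneg _ _),
      -- The parameters $s$ sent into the quadrant lie in $[F_\mu(v),F_\nu(u)]$. Every plan gives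
      -- the quadrant at least the mass $F_\nu(u)-F_\mu(v)$.
      ← Real.volume_Icc]
    refine measure_mono ?_
    rintro s ⟨⟨hsu, hsv⟩, hs⟩
    refine ⟨?_, le_cdf_of_quantile_le ν hs.2 hsu⟩
    by_contra! hlt
    exact absurd (quantile_le_of_lt_cdf μ hs.1 hlt) (not_le.2 hsv)
  refine hle.trans (tsub_le_iff_right.2 ?_)
  rw [← h1, ← h2, Measure.fst_apply measurableSet_Iic, Measure.snd_apply measurableSet_Iic]
  refine (measure_mono ?_).trans (measure_union_le _ _)
  intro p hp
  by_cases hv : p.2 ≤ v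
  · exact Or.inr hv
  · exact Or.inl ⟨hp, not_le.1 hv⟩

theorem lintegral_comonotonePlan_le {π : Measure (ℝ × ℝ)} (h1 : π.fst = (ν : Measure ℝ))
    (h2 : π.snd = (μ : Measure ℝ)) :
    ∫⁻ s, ENNReal.ofReal (quantile μ s - quantile ν s) ^ 2 ∂unitMeasure
      ≤ ∫⁻ p, ENNReal.ofReal (p.2 - p.1) ^ 2 ∂π := by
  have hπ : IsProbabilityMeasure π := ⟨by rw [← Measure.fst_univ, h1]; simp⟩
  have := lintegral_map' (μ := unitMeasure) (g := fun s => (quantile ν s, quantile μ s))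
    (f := fun p : ℝ × ℝ => ENNReal.ofReal (p.2 - p.1) ^ 2) (by fun_prop)
    (aemeasurable_quantile_prodMk ν μ)
  rw [← this]
  change ∫⁻ p, _ ∂(comonotonePlan ν μ) ≤ _
  rw [lintegral_ofReal_sub_sq, lintegral_ofReal_sub_sq]
  refine mul_le_mul_right (lintegral_mono fun q => ?_) _
  rw [← Prod.mk.eta (p := q), lintegral_triangle, lintegral_triangle]
  split_ifs
  · exact comonotonePlan_quadrant_le ν μ h1 h2 _ _
  · exact le_rfl

/-- Splits the cost into two one-sided costs. The comonotone plan minimizes both at once, the second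
after swapping coordinates. -/
theorem edist_sq_eq (x y : ℝ) :
    edist x y ^ 2 = ENNReal.ofReal (y - x) ^ 2 + ENNReal.ofReal (x - y) ^ 2 := by
  rw [edist_dist, Real.dist_eq]
  rcases le_total x y with h | h
  · rw [abs_of_nonpos (by linarith), ENNReal.ofReal_of_nonpos (p := x - y) (by linarith)]
    simp
  · rw [abs_of_nonneg (by linarith), ENNReal.ofReal_of_nonpos (p := y - x) (by linarith)]
    simp

theorem edist_sq_eq_ofReal (x y : ℝ) : edist x y ^ 2 = ENNReal.ofReal ((x - y) ^ 2) := by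
  rw [edist_dist, Real.dist_eq, ← ENNReal.ofReal_pow (abs_nonneg _), sq_abs]

/-- On the real line the quadratic Wasserstein distance is the `L²` distance of the quantile
functions. -/
theorem W2_sq : W2 ν μ ^ 2
    = ∫⁻ s, ENNReal.ofReal ((quantile ν s - quantile μ s) ^ 2) ∂unitMeasure := by
  have hsq : ∀ x : ENNReal, (x ^ (1 / 2 : ℝ)) ^ 2 = x := fun x => by
    rw [← ENNReal.rpow_two, ← ENNReal.rpow_mul]
    norm_num
  rw [W2, hsq]
  simp_rw [← edist_sq_eq_ofReal]
  refine le_antisymm ?_ (le_iInf₂ fun π hπ => ?_)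
  · refine iInf₂_le_of_le (comonotonePlan ν μ) ⟨comonotonePlan_fst ν μ, comonotonePlan_snd ν μ⟩ ?_
    rw [comonotonePlan, lintegral_map' (by fun_prop) (aemeasurable_quantile_prodMk ν μ)]
  · have hπp : IsProbabilityMeasure π := ⟨by rw [← Measure.fst_univ, hπ.1]; simp⟩
    have hswap : ∫⁻ p, ENNReal.ofReal (p.1 - p.2) ^ 2 ∂π
        = ∫⁻ p, ENNReal.ofReal (p.2 - p.1) ^ 2 ∂(π.map Prod.swap) := by
      rw [lintegral_map (by fun_prop) measurable_swap]
      rfl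
    simp_rw [edist_sq_eq]
    have hqν := aemeasurable_quantile ν
    have hqμ := aemeasurable_quantile μ
    rw [lintegral_add_left' (by fun_prop), lintegral_add_left' (by fun_prop), hswap]
    refine add_le_add (lintegral_comonotonePlan_le ν μ hπ.1 hπ.2)
      (lintegral_comonotonePlan_le μ ν ?_ ?_)
    · rw [Measure.fst_map_swap, hπ.2]
    · rw [Measure.snd_map_swap, hπ.1]

theorem memLp_quantile {ν : ProbabilityMeasure ℝ}
    (hν : MemLp (fun z : ℝ => z) 2 (ν : Measure ℝ)) : MemLp (quantile ν) 2 unitMeasure := by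
  rw [← map_quantile ν] at hν
  exact (memLp_map_measure_iff hν.1 (aemeasurable_quantile ν)).1 hν

/-! ### The Fréchet function in terms of quantiles. -/

section Frechet

variable {n : ℕ} {μ : Fin n → ProbabilityMeasure ℝ} {w : Fin n → ℝ}

theorem memLp_baryQuantile (hμ : ∀ i, MemLp (fun z : ℝ => z) 2 (μ i : Measure ℝ)) :
    MemLp (baryQuantile μ w) 2 unitMeasure :=
  memLp_finsetSum _ fun i _ => (memLp_quantile (hμ i)).const_mul (w i)

theorem lintegral_variance_ne_top
    (hμ : ∀ i, MemLp (fun z : ℝ => z) 2 (μ i : Measure ℝ)) :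
    ∫⁻ s, ENNReal.ofReal (∑ i, w i * (baryQuantile μ w s - quantile (μ i) s) ^ 2) ∂unitMeasure
      ≠ ⊤ := by
  refine Integrable.lintegral_lt_top ?_ |>.ne
  exact integrable_finsetSum _ fun i _ =>
    ((memLp_baryQuantile hμ).sub (memLp_quantile (hμ i))).integrable_sq.const_mul (w i)

/-- The bias-variance decomposition of the Fréchet function. -/
theorem frechet_eq (hw : w ∈ stdSimplex ℝ (Fin n)) (ν : ProbabilityMeasure ℝ) :
    frechet μ w ν
      = ∫⁻ s, ENNReal.ofReal ((quantile ν s - baryQuantile μ w s) ^ 2) ∂unitMeasure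
        + ∫⁻ s, ENNReal.ofReal (∑ i, w i * (baryQuantile μ w s - quantile (μ i) s) ^ 2)
          ∂unitMeasure := by
  have hν := aemeasurable_quantile ν
  have hB := (monoRightCont_baryQuantile μ hw).aemeasurable
  have hi := fun i => aemeasurable_quantile (μ i)
  have hνi : ∀ i, AEMeasurable (fun s => (quantile ν s - quantile (μ i) s) ^ 2) unitMeasure :=
    fun i => (hν.sub (hi i)).pow_const 2
  have hνB : AEMeasurable (fun s => (quantile ν s - baryQuantile μ w s) ^ 2) unitMeasure :=
    (hν.sub hB).pow_const 2
  simp only [frechet, W2_sq]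
  rw [← lintegral_add_left' hνB.ennreal_ofReal]
  have h1 : ∀ i, ENNReal.ofReal (w i)
        * ∫⁻ s, ENNReal.ofReal ((quantile ν s - quantile (μ i) s) ^ 2) ∂unitMeasure
      = ∫⁻ s, ENNReal.ofReal (w i * (quantile ν s - quantile (μ i) s) ^ 2) ∂unitMeasure := by
    intro i
    rw [← lintegral_const_mul'' _ (hνi i).ennreal_ofReal]
    exact lintegral_congr fun s => (ENNReal.ofReal_mul (hw.1 i)).symm
  rw [Finset.sum_congr rfl fun i _ => h1 i,
    ← lintegral_finsetSum' _ fun i _ => ((hνi i).const_mul (w i)).ennreal_ofReal]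
  refine lintegral_congr fun s => ?_
  rw [← ENNReal.ofReal_add (sq_nonneg _)
      (Finset.sum_nonneg fun i _ => mul_nonneg (hw.1 i) (sq_nonneg _)),
    ← ENNReal.ofReal_sum_of_nonneg fun i _ => mul_nonneg (hw.1 i) (sq_nonneg _)]
  congr 1
  have h2 : ∑ i, w i * (quantile ν s - baryQuantile μ w s) ^ 2
      = (quantile ν s - baryQuantile μ w s) ^ 2 := by
    rw [← Finset.sum_mul, hw.2, one_mul]
  -- The cross term vanishes because $g_B(s)$ is the weighted mean of the $g_{\mu_i}(s)$.
  have h3 : ∑ i, w i * (baryQuantile μ w s - quantile (μ i) s) = 0 := by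
    simp only [mul_sub, Finset.sum_sub_distrib, ← Finset.sum_mul, hw.2, one_mul]
    exact sub_self _
  have h4 : ∑ i, w i * (quantile ν s - quantile (μ i) s) ^ 2
      = ∑ i, w i * (quantile ν s - baryQuantile μ w s) ^ 2
        + ∑ i, w i * (baryQuantile μ w s - quantile (μ i) s) ^ 2
        + 2 * (quantile ν s - baryQuantile μ w s)
          * ∑ i, w i * (baryQuantile μ w s - quantile (μ i) s) := by
    rw [Finset.mul_sum, ← Finset.sum_add_distrib, ← Finset.sum_add_distrib]
    exact Finset.sum_congr rfl fun i _ => by ring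
  rw [h4, h3, h2, mul_zero, add_zero]

theorem frechet_eq_of_eqOn_baryQuantile (hw : w ∈ stdSimplex ℝ (Fin n))
    {ν : ProbabilityMeasure ℝ} (hν : EqOn (quantile ν) (baryQuantile μ w) (Ioo 0 1)) :
    frechet μ w ν = ∫⁻ s, ENNReal.ofReal
      (∑ i, w i * (baryQuantile μ w s - quantile (μ i) s) ^ 2) ∂unitMeasure := by
  rw [frechet_eq hw, setLIntegral_congr_fun measurableSet_Ioo (g := fun _ => 0)]
  · simp
  · intro s hs
    simp [hν hs]

theorem frechetVar_eq (hw : w ∈ stdSimplex ℝ (Fin n)) :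
    frechetVar μ w = ∫⁻ s, ENNReal.ofReal
      (∑ i, w i * (baryQuantile μ w s - quantile (μ i) s) ^ 2) ∂unitMeasure := by
  obtain ⟨ν, hν⟩ := (monoRightCont_baryQuantile μ hw).exists_eqOn_quantile
  refine le_antisymm ?_ (le_iInf fun ν' => ?_)
  · exact (iInf_le _ ν).trans (frechet_eq_of_eqOn_baryQuantile hw hν).le
  · rw [frechet_eq hw]
    exact le_add_self

end Frechet

/-! ### Extended integrals. -/

section ExtIntegral

variable {α : Type*} [MeasurableSpace α] {m : Measure α} {f g q : α → ℝ}

theorem extIntegral_mono_ae (h : ∀ᵐ x ∂m, f x ≤ g x) : extIntegral m f ≤ extIntegral m g := by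
  refine EReal.sub_le_sub ?_ ?_
  · exact EReal.coe_ennreal_le_coe_ennreal_iff.2
      (lintegral_mono_ae (h.mono fun x hx => ENNReal.ofReal_le_ofReal hx))
  · exact EReal.coe_ennreal_le_coe_ennreal_iff.2
      (lintegral_mono_ae (h.mono fun x hx => ENNReal.ofReal_le_ofReal (neg_le_neg hx)))

theorem extIntegral_congr_ae (h : ∀ᵐ x ∂m, f x = g x) : extIntegral m f = extIntegral m g :=
  le_antisymm (extIntegral_mono_ae (h.mono fun _ hx => hx.le))
    (extIntegral_mono_ae (h.mono fun _ hx => hx.ge))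

theorem extIntegral_eq_bot (h : ∫⁻ x, ENNReal.ofReal (-f x) ∂m = ⊤) : extIntegral m f = ⊥ := by
  simp [extIntegral, h]

theorem extIntegral_eq_toReal (h1 : ∫⁻ x, ENNReal.ofReal (f x) ∂m ≠ ⊤)
    (h2 : ∫⁻ x, ENNReal.ofReal (-f x) ∂m ≠ ⊤) :
    extIntegral m f = (((∫⁻ x, ENNReal.ofReal (f x) ∂m).toReal
      - (∫⁻ x, ENNReal.ofReal (-f x) ∂m).toReal : ℝ) : EReal) := by
  rw [extIntegral, EReal.coe_sub, EReal.coe_ennreal_toReal h1, EReal.coe_ennreal_toReal h2]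

theorem extIntegral_eq_integral (hf : Integrable f m) :
    extIntegral m f = ((∫ x, f x ∂m : ℝ) : EReal) := by
  rw [integral_eq_lintegral_pos_part_sub_lintegral_neg_part hf,
    extIntegral_eq_toReal hf.lintegral_lt_top.ne hf.neg.lintegral_lt_top.ne]

theorem integrable_of_lintegral_ne_top (hf : AEMeasurable f m)
    (h1 : ∫⁻ x, ENNReal.ofReal (f x) ∂m ≠ ⊤)
    (h2 : ∫⁻ x, ENNReal.ofReal (-f x) ∂m ≠ ⊤) : Integrable f m := by
  refine ⟨hf.aestronglyMeasurable, ?_⟩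
  rw [hasFiniteIntegral_iff_norm]
  refine lt_of_le_of_lt (lintegral_mono fun x => ?_)
    (lt_of_eq_of_lt (lintegral_add_left' hf.ennreal_ofReal _)
      (ENNReal.add_lt_top.2 ⟨h1.lt_top, h2.lt_top⟩))
  rw [Real.norm_eq_abs]
  rcases abs_cases (f x) with h | h <;> rw [h.1] <;> simp

/-- The extended integral of a difference, for a subtrahend with finite integral. -/
theorem extIntegral_sub (hf : AEMeasurable f m) (hq : AEMeasurable q m) (hq0 : ∀ x, 0 ≤ q x)
    (hf1 : ∫⁻ x, ENNReal.ofReal (f x) ∂m ≠ ⊤) (hq1 : ∫⁻ x, ENNReal.ofReal (q x) ∂m ≠ ⊤) :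
    extIntegral m f - ((∫⁻ x, ENNReal.ofReal (q x) ∂m : ENNReal) : EReal)
      = extIntegral m fun x => f x - q x := by
  have hp1 : ∫⁻ x, ENNReal.ofReal (f x - q x) ∂m ≠ ⊤ := ne_top_of_le_ne_top hf1
    (lintegral_mono fun x => ENNReal.ofReal_le_ofReal (by linarith [hq0 x]))
  -- With $p=f-q$, this integrates the pointwise identity $f^++p^-=f^-+q+p^+$, an additive form that
  -- avoids $\infty-\infty$.
  have hadd : ∫⁻ x, ENNReal.ofReal (f x) ∂m + ∫⁻ x, ENNReal.ofReal (-(f x - q x)) ∂m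
      = ∫⁻ x, ENNReal.ofReal (-f x) ∂m + ∫⁻ x, ENNReal.ofReal (q x) ∂m
        + ∫⁻ x, ENNReal.ofReal (f x - q x) ∂m := by
    rw [← lintegral_add_left' (by fun_prop), ← lintegral_add_left' (by fun_prop),
      ← lintegral_add_left' (by fun_prop)]
    refine lintegral_congr fun x => ?_
    have h0 := hq0 x
    rw [← ENNReal.toReal_eq_toReal_iff' (by finiteness) (by finiteness),
      ENNReal.toReal_add (by finiteness) (by finiteness),
      ENNReal.toReal_add (by finiteness) (by finiteness),
      ENNReal.toReal_add (by finiteness) (by finiteness)]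
    simp only [ENNReal.toReal_ofReal']
    rw [max_eq_left h0]
    rcases max_cases (f x) 0 with h | h <;> rcases max_cases (-f x) 0 with h' | h' <;>
      rcases max_cases (f x - q x) 0 with h'' | h'' <;>
      rcases max_cases (-(f x - q x)) 0 with h''' | h''' <;> linarith
  by_cases hf2 : ∫⁻ x, ENNReal.ofReal (-f x) ∂m = ⊤
  · have : ∫⁻ x, ENNReal.ofReal (-(f x - q x)) ∂m = ⊤ := by
      rw [hf2, top_add, top_add, ENNReal.add_eq_top] at hadd
      exact hadd.resolve_left hf1
    rw [extIntegral_eq_bot hf2, extIntegral_eq_bot this, EReal.bot_sub]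
  · have hp2 : ∫⁻ x, ENNReal.ofReal (-(f x - q x)) ∂m ≠ ⊤ := by
      refine ne_top_of_le_ne_top ?_ (le_add_self.trans hadd.le)
      finiteness
    rw [extIntegral_eq_toReal hf1 hf2, extIntegral_eq_toReal hp1 hp2,
      ← EReal.coe_ennreal_toReal hq1, ← EReal.coe_sub]
    have h := congrArg ENNReal.toReal hadd
    rw [ENNReal.toReal_add hf1 hp2, ENNReal.toReal_add (by finiteness) hp1,
      ENNReal.toReal_add hf2 hq1] at h
    congr 1
    linarith

/-- A function below an integrable one with the same extended integral agrees with it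
almost everywhere. -/
theorem ae_eq_of_extIntegral_le (hf : AEMeasurable f m) (hg : Integrable g m)
    (hfg : ∀ᵐ x ∂m, f x ≤ g x) (h : extIntegral m g ≤ extIntegral m f) :
    ∀ᵐ x ∂m, f x = g x := by
  have h1 : ∫⁻ x, ENNReal.ofReal (f x) ∂m ≠ ⊤ := ne_top_of_le_ne_top hg.lintegral_lt_top.ne
    (lintegral_mono_ae (hfg.mono fun x hx => ENNReal.ofReal_le_ofReal hx))
  have h2 : ∫⁻ x, ENNReal.ofReal (-f x) ∂m ≠ ⊤ := fun h2 => by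
    rw [extIntegral_eq_bot h2, extIntegral_eq_integral hg] at h
    exact EReal.coe_ne_bot _ (le_bot_iff.1 h)
  have hfi := integrable_of_lintegral_ne_top hf h1 h2
  refine (integral_eq_iff_of_ae_le hfi hg hfg).1 (le_antisymm (integral_mono_ae hfi hg hfg) ?_)
  rwa [extIntegral_eq_integral hg, extIntegral_eq_integral hfi, EReal.coe_le_coe_iff] at h

end ExtIntegral

/-! ### The pointwise maximization problem. -/

variable {Φ : ℝ → ℝ} {c γ y y' z z' : ℝ}

/-- The point `z` maximizes `Φ z - c * (z - y) ^ 2`. -/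
def IsBest (c : ℝ) (Φ : ℝ → ℝ) (y z : ℝ) : Prop :=
  ∀ z', Φ z' - c * (z' - y) ^ 2 ≤ Φ z - c * (z - y) ^ 2

/-- Adding the two optimality inequalities cancels $\Phi$ and leaves $2c(z'-z)(y'-y)\ge0$. -/
theorem IsBest.le (hc : 0 < c) (h : IsBest c Φ y z) (h' : IsBest c Φ y' z') (hy : y < y') :
    z ≤ z' := by
  have h1 := h z'
  have h2 := h' z
  by_contra! hlt
  nlinarith [mul_pos hc (mul_pos (sub_pos.2 hlt) (sub_pos.2 hy))]

/-- The graph of the argmax relation is closed: along the filter, values at the competitor are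
continuous in $y$, and values at the limit can only jump up. It serves for closedness of the argmax,
for right limits, and for passing from almost everywhere to everywhere. -/
theorem IsBest.of_frequently {α : Type*} {l : Filter α} {Y Z : α → ℝ}
    (hΦ : UpperSemicontinuous Φ) (hY : Tendsto Y l (𝓝 y)) (hZ : Tendsto Z l (𝓝 z))
    (h : ∃ᶠ t in l, IsBest c Φ (Y t) (Z t)) : IsBest c Φ y z := by
  intro z'
  by_contra! hlt
  set ε := (Φ z' - c * (z' - y) ^ 2 - (Φ z - c * (z - y) ^ 2)) / 3 with hε
  have hε0 : 0 < ε := by rw [hε]; linarith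
  have h1 : ∀ᶠ t in l, Φ (Z t) < Φ z + ε := hZ.eventually (hΦ z _ (by linarith))
  have h2 : ∀ᶠ t in l, c * (z - y) ^ 2 - ε < c * (Z t - Y t) ^ 2 :=
    (((hZ.sub hY).pow 2).const_mul c).eventually (lt_mem_nhds (by linarith))
  have h3 : ∀ᶠ t in l, c * (z' - Y t) ^ 2 < c * (z' - y) ^ 2 + ε :=
    (((hY.const_sub z').pow 2).const_mul c).eventually (gt_mem_nhds (by linarith))
  obtain ⟨t, ht, ht1, ht2, ht3⟩ := (h.and_eventually (h1.and (h2.and h3))).exists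
  have := ht z'
  linarith

/-- The penalized function is coercive, uniformly up to a quadratic error. -/
theorem exists_penalized_le (h : ∃ a b : ℝ, b < c ∧ ∀ z, Φ z ≤ a + b * z ^ 2) :
    ∃ a K δ : ℝ, 0 < δ ∧ ∀ z y, Φ z - c * (z - y) ^ 2 ≤ a + K * y ^ 2 - δ * (z - y) ^ 2 := by
  obtain ⟨a, b, hbc, hab⟩ := h
  -- Split $c=(c-m)+m$: the first part survives as $\delta$, while $bz^2-m(z-y)^2$ has maximum
  -- $Ky^2$ in $z$, by completing the square.
  set m := (b + c) / 2 with hm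
  have hmb : 0 < m - b := by rw [hm]; linarith
  refine ⟨a, m ^ 2 / (m - b) - m, c - m, by rw [hm]; linarith, fun z y => ?_⟩
  have h1 : m * (z - y) ^ 2 - b * z ^ 2 + (m ^ 2 / (m - b) - m) * y ^ 2
      = (m - b) * (z - m / (m - b) * y) ^ 2 := by
    field_simp
    ring
  have h2 : 0 ≤ (m - b) * (z - m / (m - b) * y) ^ 2 := mul_nonneg hmb.le (sq_nonneg _)
  linarith [hab z]

section Existence

variable (h : ∃ a b : ℝ, b < c ∧ ∀ z, Φ z ≤ a + b * z ^ 2)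

include h

/-- Only points in a compact interval can do as well as the competitor $z=y$, so maximization
reduces to a compact set. -/
theorem exists_radius (y : ℝ) :
    ∃ r, 0 ≤ r ∧ ∀ z, Φ y ≤ Φ z - c * (z - y) ^ 2 → z ∈ Icc (y - r) (y + r) := by
  obtain ⟨a, K, δ, hδ, hb⟩ := exists_penalized_le h
  refine ⟨√((a + K * y ^ 2 - Φ y) / δ), Real.sqrt_nonneg _, fun z hz => ?_⟩
  have h1 : (z - y) ^ 2 ≤ (a + K * y ^ 2 - Φ y) / δ := by
    rw [le_div_iff₀ hδ]
    linarith [hb z y]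
  have h2 := abs_le.1 (Real.abs_le_sqrt h1)
  constructor <;> linarith [h2.1, h2.2]

theorem exists_isBest (hΦ : UpperSemicontinuous Φ) (y : ℝ) : ∃ z, IsBest c Φ y z := by
  obtain ⟨r, hr, hb⟩ := exists_radius h y
  have hcont : Continuous fun z : ℝ => -(c * (z - y) ^ 2) := by fun_prop
  have husc : UpperSemicontinuous fun z => Φ z + -(c * (z - y) ^ 2) :=
    hΦ.add hcont.upperSemicontinuous
  obtain ⟨z, -, hz⟩ := (husc.upperSemicontinuousOn (Icc (y - r) (y + r))).exists_isMaxOn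
    (nonempty_Icc.2 (by linarith)) isCompact_Icc
  refine ⟨z, fun z' => ?_⟩
  have hy : Φ y + -(c * (y - y) ^ 2) ≤ Φ z + -(c * (z - y) ^ 2) :=
    hz ⟨by linarith, by linarith⟩
  by_cases hz' : Φ y ≤ Φ z' - c * (z' - y) ^ 2
  · have : Φ z' + -(c * (z' - y) ^ 2) ≤ Φ z + -(c * (z - y) ^ 2) := hz (hb z' hz')
    linarith
  · simp only [sub_self] at hy
    linarith

theorem exists_isGreatest_isBest (hΦ : UpperSemicontinuous Φ) (y : ℝ) :
    ∃ z, IsGreatest {z | IsBest c Φ y z} z := by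
  obtain ⟨r, -, hb⟩ := exists_radius h y
  have hclosed : IsClosed {z | IsBest c Φ y z} := isClosed_iff_frequently.2 fun z hz =>
    IsBest.of_frequently hΦ tendsto_const_nhds tendsto_id hz
  have hbdd : BddAbove {z | IsBest c Φ y z} := ⟨y + r, fun z hz =>
    (hb z (by simpa using hz y)).2⟩
  exact ⟨_, hclosed.isGreatest_csSup (exists_isBest h hΦ y) hbdd⟩

/-- Composing a monotone right-continuous function with the largest maximizer gives a monotone
right-continuous function. -/
theorem MonoRightCont.exists_isBest (hc : 0 < c) (hΦ : UpperSemicontinuous Φ) {k : ℝ → ℝ}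
    (hk : MonoRightCont k) : ∃ g, MonoRightCont g ∧ ∀ s, IsBest c Φ (k s) (g s) := by
  choose T hT using exists_isGreatest_isBest h hΦ
  have hmono : MonotoneOn (fun s => T (k s)) (Ioo 0 1) := fun s hs t ht hst => by
    rcases (hk.mono hs ht hst).eq_or_lt with heq | hlt
    · exact (congrArg T heq).le
    · exact IsBest.le hc (hT _).1 (hT _).1 hlt
  refine ⟨fun s => T (k s), ⟨hmono, fun s hs => ?_⟩, fun s => (hT _).1⟩
  have hsub : Ioo s 1 ⊆ Ioo 0 1 := Ioo_subset_Ioo_left hs.1.le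
  have hlow : ∀ x ∈ (fun s => T (k s)) '' Ioo s 1, T (k s) ≤ x := by
    rintro _ ⟨t, ht, rfl⟩
    exact hmono hs (hsub ht) ht.1.le
  have hne : (Ioo s 1).Nonempty := nonempty_Ioo.2 hs.2
  -- The right limit is at least $T(k(s))$ by monotonicity and is itself best for $k(s)$ by
  -- closedness. As $T$ picks the largest best point, the two agree.
  have hlim := (hmono.mono hsub).tendsto_nhdsWithin_Ioo_right hne ⟨_, hlow⟩
  have hbest := IsBest.of_frequently hΦ (hk.rightCont s hs) hlim
    (Frequently.of_forall fun t => (hT (k t)).1)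
  have heq : sInf ((fun s => T (k s)) '' Ioo s 1) = T (k s) :=
    le_antisymm ((hT _).2 hbest) (le_csInf (hne.image _) hlow)
  rwa [heq] at hlim

end Existence

/-- The penalized function differs from minus the strictly convex one by a function affine in $z$,
so the midpoint of two distinct maximizers would do better. -/
theorem IsBest.eq_of_strictConvexOn
    (hΦ : StrictConvexOn ℝ univ fun z => z ^ 2 / (2 * γ) - Φ z)
    (h : IsBest (1 / (2 * γ)) Φ y z) (h' : IsBest (1 / (2 * γ)) Φ y z') : z = z' := by
  by_contra hne
  have h1 := hΦ.2 (mem_univ z) (mem_univ z') hne (by norm_num : (0 : ℝ) < 1 / 2)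
    (by norm_num : (0 : ℝ) < 1 / 2) (by norm_num)
  have h2 := h (1 / 2 * z + 1 / 2 * z')
  have h3 := h' (1 / 2 * z + 1 / 2 * z')
  simp only [smul_eq_mul] at h1
  simp only [div_eq_mul_inv _ (2 * γ)] at h1 h2 h3
  nlinarith

theorem IsBest.firstOrder (hγ : 0 < γ) (hΦ : DifferentiableAt ℝ Φ z)
    (h : IsBest (1 / (2 * γ)) Φ y z) : z - γ * deriv Φ z - y = 0 := by
  have hmax : IsLocalMax (fun z => Φ z - 1 / (2 * γ) * (z - y) ^ 2) z := Eventually.of_forall h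
  have hd : HasDerivAt (fun z => Φ z - 1 / (2 * γ) * (z - y) ^ 2)
      (deriv Φ z - 1 / (2 * γ) * (2 * (z - y))) z := by
    have := ((hasDerivAt_id z).sub_const y).pow 2 |>.const_mul (1 / (2 * γ))
    simpa using hΦ.hasDerivAt.fun_sub this
  have := hmax.hasDerivAt_eq_zero hd
  field_simp at this
  linarith

/-! ### Consequences of the one-sided Lipschitz bound for small $\gamma$. -/

section SmallGamma

variable {L : ℝ} (hd : Differentiable ℝ Φ)
  (hL : ∀ x y, x ≤ y → deriv Φ y - deriv Φ x ≤ L * (y - x))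

include hL

theorem strictMono_firstOrder (hγ : 0 < γ) (hγL : γ * L < 1) :
    StrictMono fun z => z - γ * deriv Φ z := by
  intro x y hxy
  have := mul_le_mul_of_nonneg_left (hL x y hxy.le) hγ.le
  have h2 := mul_pos (sub_pos.2 hγL) (sub_pos.2 hxy)
  simp only
  nlinarith

include hd

/-- The derivative is the first-order function $z-\gamma\Phi'(z)$ divided by $\gamma$, which is
strictly increasing. -/
theorem strictConvexOn_penalty (hγ : 0 < γ) (hγL : γ * L < 1) :
    StrictConvexOn ℝ univ fun z => z ^ 2 / (2 * γ) - Φ z := by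
  have hderiv : deriv (fun z => z ^ 2 / (2 * γ) - Φ z) = fun z => (z - γ * deriv Φ z) / γ := by
    funext z
    have h1 : HasDerivAt (fun z : ℝ => z ^ 2 / (2 * γ)) (2 * z / (2 * γ)) z := by
      simpa using (hasDerivAt_pow 2 z).div_const (2 * γ)
    rw [(h1.fun_sub (hd z).hasDerivAt).deriv]
    field_simp
  refine StrictMono.strictConvexOn_univ_of_deriv ?_ ?_
  · have := hd.continuous
    fun_prop
  · rw [hderiv]
    intro x y hxy
    exact div_lt_div_of_pos_right (strictMono_firstOrder hL hγ hγL hxy) hγ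

/-- The derivative of right side minus left side has the sign of $z$, by comparing $\Phi'$ with its
value at $0$; the difference is thus smallest at $0$, where it vanishes. -/
theorem le_quadratic (z : ℝ) : Φ z ≤ Φ 0 + deriv Φ 0 * z + L / 2 * z ^ 2 := by
  set f : ℝ → ℝ := fun z => Φ 0 + deriv Φ 0 * z + L / 2 * z ^ 2 - Φ z with hf
  have hderiv : ∀ z, HasDerivAt f (deriv Φ 0 + L * z - deriv Φ z) z := fun z => by
    have h1 : HasDerivAt (fun z : ℝ => Φ 0 + deriv Φ 0 * z + L / 2 * z ^ 2)
        (deriv Φ 0 + L * z) z := by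
      have := (((hasDerivAt_id' z).const_mul (deriv Φ 0)).const_add (Φ 0)).fun_add
        ((hasDerivAt_pow 2 z).const_mul (L / 2))
      refine this.congr_deriv ?_
      push_cast
      ring
    exact h1.fun_sub (hd z).hasDerivAt
  have hcont : Continuous f :=
    continuous_iff_continuousAt.2 fun z => (hderiv z).continuousAt
  have hdiff : Differentiable ℝ f := fun z => (hderiv z).differentiableAt
  have h0 : f 0 = 0 := by simp [hf]
  have hnn : 0 ≤ f z := by
    rcases le_total 0 z with hz | hz
    · have := monotoneOn_of_deriv_nonneg (convex_Ici 0) hcont.continuousOn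
        hdiff.differentiableOn (fun x hx => by
          rw [interior_Ici] at hx
          rw [(hderiv x).deriv]
          linarith [hL 0 x (le_of_lt hx)]) self_mem_Ici (mem_Ici.2 hz) hz
      rwa [h0] at this
    · have := antitoneOn_of_deriv_nonpos (convex_Iic 0) hcont.continuousOn
        hdiff.differentiableOn (fun x hx => by
          rw [interior_Iic] at hx
          rw [(hderiv x).deriv]
          linarith [hL x 0 (le_of_lt hx)]) (mem_Iic.2 hz) self_mem_Iic hz
      rwa [h0] at this
  simp only [hf] at hnn
  linarith

theorem subquadraticAbove_of_small (hγ : 0 < γ) (hγL : γ * L < 1) : SubquadraticAbove γ Φ := by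
  have hlt : L / 2 < 1 / (2 * γ) := by
    rw [div_lt_div_iff₀ (by norm_num) (by positivity)]
    linarith
  -- Half of the gap between $L/2$ and $1/(2\gamma)$ absorbs the linear term by Young's inequality.
  set δ := (1 / (2 * γ) - L / 2) / 2 with hδ
  have hδ0 : 0 < δ := by rw [hδ]; linarith
  refine ⟨Φ 0 + (deriv Φ 0) ^ 2 / (4 * δ), L / 2 + δ, by rw [hδ]; linarith, fun z => ?_⟩
  have h1 := le_quadratic hd hL z
  have h2 : (deriv Φ 0) ^ 2 / (4 * δ) + δ * z ^ 2 - deriv Φ 0 * z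
      = (deriv Φ 0 - 2 * δ * z) ^ 2 / (4 * δ) := by
    field_simp
    ring
  have h3 : 0 ≤ (deriv Φ 0 - 2 * δ * z) ^ 2 / (4 * δ) := by positivity
  linarith

end SmallGamma

/-! ### From the pointwise problem to the risk measure. -/

section Objective

variable {n : ℕ} {μ : Fin n → ProbabilityMeasure ℝ} {w : Fin n → ℝ} {γ : ℝ} {Φ₀ g h : ℝ → ℝ}

theorem extIntegral_quantile (hΦ : Measurable Φ₀) (ν : ProbabilityMeasure ℝ) :
    extIntegral (ν : Measure ℝ) Φ₀ = extIntegral unitMeasure fun s => Φ₀ (quantile ν s) := by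
  have hq := aemeasurable_quantile ν
  simp only [extIntegral]
  rw [← map_quantile ν, lintegral_map' (by fun_prop) hq, lintegral_map' (by fun_prop) hq]

theorem quantileObjective_congr (hgh : EqOn g h (Ioo 0 1)) :
    quantileObjective μ w γ Φ₀ g = quantileObjective μ w γ Φ₀ h := by
  refine extIntegral_congr_ae ?_
  filter_upwards [ae_restrict_mem measurableSet_Ioo] with s hs
  rw [hgh hs]

theorem MonoRightCont.aemeasurable_penalized (hΦ : Measurable Φ₀)
    (hw : w ∈ stdSimplex ℝ (Fin n)) (hg : MonoRightCont g) :
    AEMeasurable (fun s => Φ₀ (g s) - 1 / (2 * γ) * (g s - baryQuantile μ w s) ^ 2)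
      unitMeasure :=
  (hΦ.comp_aemeasurable hg.aemeasurable).sub
    (((hg.aemeasurable.sub (monoRightCont_baryQuantile μ hw).aemeasurable).pow_const 2).const_mul _)

theorem riskObjective_eq (hμ : ∀ i, MemLp (fun z : ℝ => z) 2 (μ i : Measure ℝ))
    (hw : w ∈ stdSimplex ℝ (Fin n)) (hγ : 0 < γ) (hΦ : Measurable Φ₀)
    (hsub : SubquadraticAbove γ Φ₀) (ν : ProbabilityMeasure ℝ) :
    riskObjective μ w γ Φ₀ ν = quantileObjective μ w γ Φ₀ (quantile ν) := by
  obtain ⟨a, K, δ, hδ, hb⟩ := exists_penalized_le hsub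
  have hc : 0 < 1 / (2 * γ) := by positivity
  have hν := aemeasurable_quantile ν
  have hB := (monoRightCont_baryQuantile μ hw).aemeasurable
  have hνB : AEMeasurable (fun s => (quantile ν s - baryQuantile μ w s) ^ 2) unitMeasure :=
    (hν.sub hB).pow_const 2
  set D := ∫⁻ s, ENNReal.ofReal ((quantile ν s - baryQuantile μ w s) ^ 2) ∂unitMeasure with hD
  have hR : frechetVar μ w ≠ ⊤ := by
    rw [frechetVar_eq hw]
    exact lintegral_variance_ne_top hμ
  have hdiff : (frechet μ w ν : EReal) - (frechetVar μ w : EReal) = (D : EReal) := by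
    rw [frechet_eq hw, ← frechetVar_eq hw, ← hD, EReal.coe_ennreal_add,
      ← EReal.coe_ennreal_toReal hR, EReal.add_sub_cancel_right]
  have hmul : ((1 / (2 * γ) : ℝ) : EReal) * (D : EReal)
      = ((∫⁻ s, ENNReal.ofReal (1 / (2 * γ) * (quantile ν s - baryQuantile μ w s) ^ 2)
          ∂unitMeasure : ENNReal) : EReal) := by
    simp only [ENNReal.ofReal_mul hc.le]
    rw [lintegral_const_mul'' _ hνB.ennreal_ofReal, ← hD, EReal.coe_ennreal_mul,
      EReal.coe_ennreal_ofReal, max_eq_left hc.le]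
  have hbound : ∫⁻ s, ENNReal.ofReal (a + K * baryQuantile μ w s ^ 2) ∂unitMeasure ≠ ⊤ :=
    ((integrable_const a).add
      ((memLp_baryQuantile hμ).integrable_sq.const_mul K)).lintegral_lt_top.ne
  rw [riskObjective, hdiff, quantileObjective, extIntegral_quantile hΦ]
  by_cases hDtop : D = ⊤
  -- When $g_\nu-g_B\notin L^2$ both sides are $-\infty$: coercivity bounds
  -- $\delta\int(g_\nu-g_B)^2$ by a finite integral plus the negative part of the integrand of $J$.
  · rw [hDtop, EReal.coe_ennreal_top, EReal.coe_mul_top_of_pos hc, EReal.sub_top]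
    refine (extIntegral_eq_bot ?_).symm
    by_contra hN
    have hle : ENNReal.ofReal δ * D ≤
        ∫⁻ s, ENNReal.ofReal (a + K * baryQuantile μ w s ^ 2) ∂unitMeasure
        + ∫⁻ s, ENNReal.ofReal (-(Φ₀ (quantile ν s)
          - 1 / (2 * γ) * (quantile ν s - baryQuantile μ w s) ^ 2)) ∂unitMeasure := by
      rw [hD, ← lintegral_const_mul'' _ hνB.ennreal_ofReal,
        ← lintegral_add_left' (((hB.pow_const 2).const_mul K).const_add a).ennreal_ofReal]
      refine lintegral_mono fun s => ?_
      rw [← ENNReal.ofReal_mul hδ.le]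
      refine (ENNReal.ofReal_le_ofReal ?_).trans ENNReal.ofReal_add_le
      linarith [hb (quantile ν s) (baryQuantile μ w s)]
    rw [hDtop, ENNReal.mul_top (by simpa using hδ), top_le_iff, ENNReal.add_eq_top] at hle
    exact hle.elim hbound hN
  · have hq1 : ∫⁻ s, ENNReal.ofReal
        (1 / (2 * γ) * (quantile ν s - baryQuantile μ w s) ^ 2) ∂unitMeasure ≠ ⊤ := by
      simp only [ENNReal.ofReal_mul hc.le]
      rw [lintegral_const_mul'' _ hνB.ennreal_ofReal]
      exact ENNReal.mul_ne_top ENNReal.ofReal_ne_top hDtop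
    rw [hmul]
    refine extIntegral_sub (hΦ.comp_aemeasurable hν) (hνB.const_mul _)
      (fun s => mul_nonneg hc.le (sq_nonneg _)) ?_ hq1
    refine ne_top_of_le_ne_top (ENNReal.add_ne_top.2 ⟨hbound, hq1⟩) ?_
    rw [← lintegral_add_left' (((hB.pow_const 2).const_mul K).const_add a).ennreal_ofReal]
    refine lintegral_mono fun s => (ENNReal.ofReal_le_ofReal ?_).trans ENNReal.ofReal_add_le
    have := mul_nonneg hδ.le (sq_nonneg (quantile ν s - baryQuantile μ w s))
    linarith [hb (quantile ν s) (baryQuantile μ w s)]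

theorem riskMeasure_eq_iSup (hμ : ∀ i, MemLp (fun z : ℝ => z) 2 (μ i : Measure ℝ))
    (hw : w ∈ stdSimplex ℝ (Fin n)) (hγ : 0 < γ) (hΦ : Measurable Φ₀)
    (hsub : SubquadraticAbove γ Φ₀) :
    riskMeasure μ w γ Φ₀ = ⨆ g ∈ quantileFunctions, quantileObjective μ w γ Φ₀ g := by
  refine le_antisymm (iSup_le fun ν => ?_) (iSup₂_le fun g hg => ?_)
  · rw [riskObjective_eq hμ hw hγ hΦ hsub]
    exact le_iSup₂ (f := fun g (_ : g ∈ quantileFunctions) => quantileObjective μ w γ Φ₀ g)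
      (quantile ν) ⟨ν, fun _ _ => rfl⟩
  · obtain ⟨ν, hν⟩ := hg
    rw [quantileObjective_congr hν, ← riskObjective_eq hμ hw hγ hΦ hsub]
    exact le_iSup (riskObjective μ w γ Φ₀) ν

theorem IsMaximizer.riskMeasure_eq (hμ : ∀ i, MemLp (fun z : ℝ => z) 2 (μ i : Measure ℝ))
    (hw : w ∈ stdSimplex ℝ (Fin n)) (hγ : 0 < γ) (hΦ : Measurable Φ₀)
    (hsub : SubquadraticAbove γ Φ₀) (hg : IsMaximizer μ w γ Φ₀ g) :
    riskMeasure μ w γ Φ₀ = quantileObjective μ w γ Φ₀ g := by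
  rw [riskMeasure_eq_iSup hμ hw hγ hΦ hsub]
  exact le_antisymm (iSup₂_le hg.2)
    (le_iSup₂ (f := fun g (_ : g ∈ quantileFunctions) => quantileObjective μ w γ Φ₀ g) g hg.1)

theorem IsMaximizer.congr (hg : IsMaximizer μ w γ Φ₀ g) (hgh : EqOn h g (Ioo 0 1)) :
    IsMaximizer μ w γ Φ₀ h := by
  refine ⟨mem_quantileFunctions_iff.2 ((mem_quantileFunctions_iff.1 hg.1).congr hgh),
    fun k hk => ?_⟩
  rw [quantileObjective_congr hgh]
  exact hg.2 k hk

theorem isMaximizer_of_isBest (hg : MonoRightCont g)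
    (hbest : ∀ s, IsBest (1 / (2 * γ)) Φ₀ (baryQuantile μ w s) (g s)) :
    IsMaximizer μ w γ Φ₀ g :=
  ⟨mem_quantileFunctions_iff.2 hg, fun h _ =>
    extIntegral_mono_ae (Eventually.of_forall fun s => hbest s (h s))⟩

/-- The optimal value lies between the value at the competitor $0$ and the coercivity bound; both
are integrable because $g_B\in L^2$. -/
theorem integrable_of_isBest (hμ : ∀ i, MemLp (fun z : ℝ => z) 2 (μ i : Measure ℝ))
    (hw : w ∈ stdSimplex ℝ (Fin n)) (hΦ : Measurable Φ₀) (hsub : SubquadraticAbove γ Φ₀)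
    (hg : MonoRightCont g)
    (hbest : ∀ s, IsBest (1 / (2 * γ)) Φ₀ (baryQuantile μ w s) (g s)) :
    Integrable (fun s => Φ₀ (g s) - 1 / (2 * γ) * (g s - baryQuantile μ w s) ^ 2)
      unitMeasure := by
  obtain ⟨a, K, δ, hδ, hb⟩ := exists_penalized_le hsub
  have hB := (memLp_baryQuantile (w := w) hμ).integrable_sq
  refine integrable_of_le_of_le (hg.aemeasurable_penalized hΦ hw).aestronglyMeasurable
    (g₁ := fun s => Φ₀ 0 - 1 / (2 * γ) * baryQuantile μ w s ^ 2)
    (g₂ := fun s => a + K * baryQuantile μ w s ^ 2)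
    (Eventually.of_forall fun s => ?_) (Eventually.of_forall fun s => ?_)
    ((integrable_const _).sub (hB.const_mul _)) ((integrable_const _).add (hB.const_mul _))
  · simpa using hbest s 0
  · have := mul_nonneg hδ.le (sq_nonneg (g s - baryQuantile μ w s))
    have := hb (g s) (baryQuantile μ w s)
    simp only
    linarith

/-- Maximizers of the integral are pointwise maximizers of the integrand, everywhere. -/
theorem IsMaximizer.isBest (hμ : ∀ i, MemLp (fun z : ℝ => z) 2 (μ i : Measure ℝ))
    (hw : w ∈ stdSimplex ℝ (Fin n)) (hγ : 0 < γ) (hΦ : Measurable Φ₀)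
    (hsub : SubquadraticAbove γ Φ₀) (husc : UpperSemicontinuous Φ₀)
    (hh : IsMaximizer μ w γ Φ₀ h) {s : ℝ} (hs : s ∈ Ioo (0 : ℝ) 1) :
    IsBest (1 / (2 * γ)) Φ₀ (baryQuantile μ w s) (h s) := by
  have hB := monoRightCont_baryQuantile μ hw
  have hhm := mem_quantileFunctions_iff.1 hh.1
  obtain ⟨g, hg, hbest⟩ := hB.exists_isBest hsub (by positivity) husc
  have hae := ae_eq_of_extIntegral_le (hhm.aemeasurable_penalized hΦ hw)
    (integrable_of_isBest hμ hw hΦ hsub hg hbest)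
    (Eventually.of_forall fun s => hbest s (h s))
    (hh.2 g (mem_quantileFunctions_iff.2 hg))
  -- Equality holds only almost everywhere; every $s$ is approached from the right by such points,
  -- along which $g_B$ and $h$ converge.
  refine IsBest.of_frequently husc (hB.rightCont s hs) (hhm.rightCont s hs)
    ((frequently_nhdsGT hae hs).mono fun t ht z => ?_)
  exact (hbest t z).trans ht.ge

/-- For $t>s$ strict monotonicity of $k$ gives $h(s)\le g(t)$, even if best points are not unique;
then $t\downarrow s$. Exchanging $g$ and $h$ gives uniqueness in the atomless case. -/
theorem MonoRightCont.le_of_isBest (hγ : 0 < γ) {k : ℝ → ℝ} (hk : StrictMonoOn k (Ioo 0 1))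
    (hg : MonoRightCont g)
    (hgb : ∀ s ∈ Ioo (0 : ℝ) 1, IsBest (1 / (2 * γ)) Φ₀ (k s) (g s))
    (hhb : ∀ s ∈ Ioo (0 : ℝ) 1, IsBest (1 / (2 * γ)) Φ₀ (k s) (h s))
    {s : ℝ} (hs : s ∈ Ioo (0 : ℝ) 1) : h s ≤ g s := by
  refine ge_of_tendsto (hg.rightCont s hs) ?_
  filter_upwards [Ioo_mem_nhdsGT_of_mem hs, self_mem_nhdsWithin] with t ht hst
  exact IsBest.le (by positivity) (hhb s hs) (hgb t ht) (hk hs ht hst)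

theorem IsMaximizer.eqOn (hμ : ∀ i, MemLp (fun z : ℝ => z) 2 (μ i : Measure ℝ))
    (hw : w ∈ stdSimplex ℝ (Fin n)) (hγ : 0 < γ) (hΦ : Measurable Φ₀)
    (hsub : SubquadraticAbove γ Φ₀) (husc : UpperSemicontinuous Φ₀)
    (hor : (∀ i, ∀ x : ℝ, (μ i : Measure ℝ) {x} = 0) ∨
      StrictConvexOn ℝ univ (fun z => z ^ 2 / (2 * γ) - Φ₀ z))
    (hg : IsMaximizer μ w γ Φ₀ g) (hh : IsMaximizer μ w γ Φ₀ h) : EqOn g h (Ioo 0 1) := by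
  have hgb := fun s hs => hg.isBest hμ hw hγ hΦ hsub husc (s := s) hs
  have hhb := fun s hs => hh.isBest hμ hw hγ hΦ hsub husc (s := s) hs
  intro s hs
  rcases hor with hat | hconv
  · have hk := strictMonoOn_baryQuantile μ hw hat
    exact le_antisymm
      ((mem_quantileFunctions_iff.1 hh.1).le_of_isBest hγ hk hhb hgb hs)
      ((mem_quantileFunctions_iff.1 hg.1).le_of_isBest hγ hk hgb hhb hs)
  · exact IsBest.eq_of_strictConvexOn hconv (hgb s hs) (hhb s hs)

theorem exists_isMaximizer (hμ : ∀ i, MemLp (fun z : ℝ => z) 2 (μ i : Measure ℝ))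
    (hw : w ∈ stdSimplex ℝ (Fin n)) (hγ : 0 < γ) (hΦ : Measurable Φ₀)
    (hsub : SubquadraticAbove γ Φ₀) (husc : UpperSemicontinuous Φ₀) :
    ∃ g, IsMaximizer μ w γ Φ₀ g ∧ riskMeasure μ w γ Φ₀ = quantileObjective μ w γ Φ₀ g ∧
      ∃ x : ℝ, quantileObjective μ w γ Φ₀ g = x := by
  obtain ⟨g, hg, hbest⟩ :=
    (monoRightCont_baryQuantile μ hw).exists_isBest hsub (by positivity) husc
  have hmax := isMaximizer_of_isBest hg hbest
  exact ⟨g, hmax, hmax.riskMeasure_eq hμ hw hγ hΦ hsub, _,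
    extIntegral_eq_integral (integrable_of_isBest hμ hw hΦ hsub hg hbest)⟩

theorem IsMaximizer.solvesFOC (hμ : ∀ i, MemLp (fun z : ℝ => z) 2 (μ i : Measure ℝ))
    (hw : w ∈ stdSimplex ℝ (Fin n)) (hγ : 0 < γ) (hΦ : Differentiable ℝ Φ₀)
    (hsub : SubquadraticAbove γ Φ₀) (hg : IsMaximizer μ w γ Φ₀ g) : SolvesFOC μ w γ Φ₀ g :=
  fun s hs => (hg.isBest hμ hw hγ hΦ.continuous.measurable hsub
    hΦ.continuous.upperSemicontinuous hs).firstOrder hγ (hΦ (g s))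

end Objective

end BarycentricRisk

theorem proposition2p4 {n : ℕ} (μ : Fin n → ProbabilityMeasure ℝ)
    (hμ : ∀ i, MemLp (fun z : ℝ => z) 2 (μ i : Measure ℝ))
    (w : Fin n → ℝ) (hw : w ∈ stdSimplex ℝ (Fin n)) (γ : ℝ) (hγ : 0 < γ) :
    -- `g_B` is the quantile function of a barycenter of the priors
    (∃ μB : ProbabilityMeasure ℝ, EqOn (quantile μB) (baryQuantile μ w) (Ioo 0 1) ∧
      frechet μ w μB = frechetVar μ w ∧ frechetVar μ w < ⊤) ∧
    -- (a) equivalence of the two problems, existence and uniqueness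
    (∀ Φ₀ : ℝ → ℝ, Measurable Φ₀ → SubquadraticAbove γ Φ₀ →
      (∀ ν : ProbabilityMeasure ℝ,
        riskObjective μ w γ Φ₀ ν = quantileObjective μ w γ Φ₀ (quantile ν)) ∧
      (riskMeasure μ w γ Φ₀ = ⨆ g ∈ quantileFunctions, quantileObjective μ w γ Φ₀ g) ∧
      (UpperSemicontinuous Φ₀ →
        (∃ g, IsMaximizer μ w γ Φ₀ g ∧
          riskMeasure μ w γ Φ₀ = quantileObjective μ w γ Φ₀ g) ∧
        riskMeasure μ w γ Φ₀ ≠ ⊥ ∧ riskMeasure μ w γ Φ₀ ≠ ⊤ ∧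
        ((∀ i, ∀ x : ℝ, (μ i : Measure ℝ) {x} = 0) ∨
            StrictConvexOn ℝ univ (fun z => z ^ 2 / (2 * γ) - Φ₀ z) →
          ∀ g h, IsMaximizer μ w γ Φ₀ g → IsMaximizer μ w γ Φ₀ h → EqOn g h (Ioo 0 1)))) ∧
    -- (b) first order condition; for small `γ` it has exactly one solution, the maximizer
    (∀ Φ₀ : ℝ → ℝ, Differentiable ℝ Φ₀ →
      (SubquadraticAbove γ Φ₀ → ∀ g, IsMaximizer μ w γ Φ₀ g → SolvesFOC μ w γ Φ₀ g) ∧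
      (∀ L : ℝ, (∀ x y, x ≤ y → deriv Φ₀ y - deriv Φ₀ x ≤ L * (y - x)) → γ * L < 1 →
        ∃ g, IsMaximizer μ w γ Φ₀ g ∧
          riskMeasure μ w γ Φ₀ = quantileObjective μ w γ Φ₀ g ∧
          ∀ h, (IsMaximizer μ w γ Φ₀ h ↔ EqOn h g (Ioo 0 1)) ∧
            (SolvesFOC μ w γ Φ₀ h ↔ EqOn h g (Ioo 0 1)))) := by
  refine ⟨?_, fun Φ₀ hΦ hsub => ⟨riskObjective_eq hμ hw hγ hΦ hsub,
    riskMeasure_eq_iSup hμ hw hγ hΦ hsub, fun husc => ?_⟩, fun Φ₀ hΦ =>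
    ⟨fun hsub g hg => hg.solvesFOC hμ hw hγ hΦ hsub, fun L hL hγL => ?_⟩⟩
  · obtain ⟨μB, hμB⟩ := (monoRightCont_baryQuantile μ hw).exists_eqOn_quantile
    refine ⟨μB, hμB, ?_, ?_⟩
    · rw [frechet_eq_of_eqOn_baryQuantile hw hμB, frechetVar_eq hw]
    · rw [frechetVar_eq hw]
      exact (lintegral_variance_ne_top hμ).lt_top
  · obtain ⟨g, hg, hrisk, x, hx⟩ := exists_isMaximizer hμ hw hγ hΦ hsub husc
    refine ⟨⟨g, hg, hrisk⟩, ?_, ?_, fun hor g h hg hh =>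
      hg.eqOn hμ hw hγ hΦ hsub husc hor hh⟩
    · rw [hrisk, hx]
      exact EReal.coe_ne_bot x
    · rw [hrisk, hx]
      exact EReal.coe_ne_top x
  · have hsub := subquadraticAbove_of_small hΦ hL hγ hγL
    have hmeas := hΦ.continuous.measurable
    have husc := hΦ.continuous.upperSemicontinuous
    obtain ⟨g, hg, hrisk, -⟩ := exists_isMaximizer hμ hw hγ hmeas hsub husc
    have hfoc := hg.solvesFOC hμ hw hγ hΦ hsub
    refine ⟨g, hg, hrisk, fun h => ⟨⟨fun hh => hh.eqOn hμ hw hγ hmeas hsub husc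
      (Or.inr (strictConvexOn_penalty hΦ hL hγ hγL)) hg, hg.congr⟩, fun hh s hs => ?_,
      fun hh s hs => ?_⟩⟩
    -- For each $s$, equation (1) prescribes the value of an injective function at $h(s)$, so no
    -- regularity of $h$ is needed.
    · refine (strictMono_firstOrder hL hγ hγL).injective ?_
      linarith [hh s hs, hfoc s hs]
    · rw [hh hs]
      exact hfoc s hs
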